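/- Let $p$ be an odd prime, $m,u$ positive integers, $v=\gcd(m,u)$, $q=p^m$, and let $\mathrm{Tr}:\mathbb{F}_q\to\mathbb{F}_p$ be the trace map. Put $$D_2=\{(x,y)\in\mathbb{F}_q^2\setminus\{(0,0)\}:\ \mathrm{Tr}(x^2+y^{p^u+1})=0\},\qquad C_{D_2}=\{(\mathrm{Tr}(ax+by))_{(x,y)\in D_2}:\ a,b\in\mathbb{F}_q\},$$ a linear code over $\mathbb{F}_p$ of length $|D_2|$. If $\frac{m}{v}\equiv0\pmod 4$, then $C_{D_2}$ has length $p^{2m-1}+p^{m+v}-p^{m+v-1}-1$ and dimension $2m$ over $\mathbb{F}_p$, and it is a three-weight code, that is, exactly three positive integers occur as Hamming weights of its codewords. Its weight distribution is as follows, where $A_w$ is the number of codewords of Hamming weight $w$: - $A_0=1$; - $A_w=(p^{m-v}-1)(p^{m-v-1}+1)$ for $w=(p-1)p^{2m-2}$; - $A_w=p^{2m}-p^{2m-2v}$ for $w=(p-1)p^{2m-2}\left(1+\frac{p-1}{p^{m-v}}\right)$; - $A_w=(p^{m-v}-1)p^{m-v-1}(p-1)$ for $w=(p-1)p^{2m-2}\left(1+\frac{1}{p^{m-v-1}}\right)$;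 - $A_w=0$ for every other $w$. -/

import Mathlib

namespace LinearCode

/-- A linear code over a field `K`, with coordinate positions indexed by a finite type `ι`, is an
`[n, k]` code if it has length `n` (the number of positions) and dimension `k` over `K`. -/
def HasParameters {K ι : Type*} [Field K] [Fintype ι]
    (C : Submodule K (ι → K)) (n k : ℕ) : Prop :=
  Fintype.card ι = n ∧ Module.finrank K C = k

/-- `A_i`: the number of codewords of `C` of Hamming weight `i`. -/
noncomputable def weightCount {K ι : Type*} [Field K] [DecidableEq K] [Fintype ι]
    (C : Submodule K (ι → K)) (i : ℕ) : ℕ :=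
  {c : ι → K | c ∈ C ∧ hammingNorm c = i}.ncard

/-- `C` is a `t`-weight code: exactly `t` of the numbers `A_1, …, A_n` are nonzero, where `n` is
the length of `C`. -/
def IsTWeight {K ι : Type*} [Field K] [DecidableEq K] [Fintype ι]
    (C : Submodule K (ι → K)) (t : ℕ) : Prop :=
  {i : ℕ | 1 ≤ i ∧ i ≤ Fintype.card ι ∧ weightCount C i ≠ 0}.ncard = t

/-- The map `(a, b) ↦ c(a, b) = (Tr(a x + b y))_{(x, y) ∈ D}`. -/
noncomputable def codeword (p : ℕ) [Fact p.Prime] {F : Type*} [Field F] [Algebra (ZMod p) F]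
    (D : Finset (F × F)) : F × F →ₗ[ZMod p] (D → ZMod p) where
  toFun ab := fun xy => Algebra.trace (ZMod p) F (ab.1 * xy.1.1 + ab.2 * xy.1.2)
  map_add' a b := by
    funext xy
    simp only [Prod.fst_add, Prod.snd_add, Pi.add_apply, ← map_add]
    congr 1
    ring
  map_smul' r a := by
    funext xy
    simp only [Prod.smul_fst, Prod.smul_snd, Pi.smul_apply, RingHom.id_apply, ← map_smul,
      smul_add, smul_mul_assoc]

/-- The code `C_D = {c(a, b) : a, b ∈ F}` with defining set `D`. -/
noncomputable def codeOf (p : ℕ) [Fact p.Prime] {F : Type*} [Field F] [Algebra (ZMod p) F]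
    (D : Finset (F × F)) : Submodule (ZMod p) (D → ZMod p) :=
  LinearMap.range (codeword p D)

/-- `D₂ = {(x, y) ∈ F² \ {(0, 0)} : Tr(x² + y^(p^u + 1)) = 0}`. -/
noncomputable def D₂ (p : ℕ) [Fact p.Prime] (F : Type*) [Field F] [Fintype F] [DecidableEq F]
    [Algebra (ZMod p) F] (u : ℕ) : Finset (F × F) :=
  {xy : F × F | xy ≠ (0, 0) ∧
    Algebra.trace (ZMod p) F (xy.1 ^ 2 + xy.2 ^ (p ^ u + 1)) = 0}

end LinearCode

/-! ### Additive character sums attached to quadratic forms over `ZMod p`. -/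

section CharacterSums

open Finset ZMod

variable {p : ℕ} [Fact p.Prime] {V : Type*} [AddCommGroup V] [Module (ZMod p) V] [Fintype V]

/-! Let `Q (x, y) = Tr (x ^ 2 + y ^ (p ^ u + 1))`, the diagonal of `pairForm` on `V = F × F`.
Codewords are linear functionals `l` restricted to the nonzero zeros of `Q`, so weights are the
numbers `#{Q = 0, l ≠ 0}` (`isotropicWeight`).

These counts need two data: the radical of `Q`, of size `p ^ (2 * v)` (`card_ker_pairForm`), and the
Gauss sums `∑ χ (s * Q X)`, which all equal `g = p ^ (m + v)` for `s ≠ 0` (`pairForm_gauss_sum`).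
The weight of `l ≠ 0` then depends only on whether `l` fails to vanish on the radical, or is the
polar functional of some `w` with `Q w = 0`, or of some `w` with `Q w ≠ 0`. The three classes give
the three weights, and their sizes follow from the number of zeros of `Q`
(`isotropicWeight_distribution`).

The Gauss sum of `Tr (y ^ (p ^ u + 1))` is found without evaluating classical Gauss sums
(`exists_int_frobeniusForm_gauss_sum`). It is an integer `S` independent of `s`, and `S ^ 2` is `p ^
m` times the size of the radical. The form is invariant under the `(p ^ v + 1)`-th roots of unity,
so `S ≡ 1` modulo `p ^ v + 1`, which fixes the sign. A linear change of variable reduces `Tr (x ^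
2)` to the same kind of form (`trace_sq_gauss_sum`). -/

theorem stdAddChar_eq_one_iff (a : ZMod p) : stdAddChar a = 1 ↔ a = 0 := by
  rw [← AddChar.map_zero_eq_one (stdAddChar (N := p)), injective_stdAddChar.eq_iff]

theorem sum_stdAddChar_linear (l : Module.Dual (ZMod p) V) [Decidable (l = 0)] :
    ∑ X, stdAddChar (l X) = if l = 0 then (Fintype.card V : ℂ) else 0 := by
  classical
  have h := AddChar.sum_eq_ite (stdAddChar.compAddMonoidHom l.toAddMonoidHom)
  have h2 : stdAddChar.compAddMonoidHom l.toAddMonoidHom = 0 ↔ l = 0 := by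
    constructor
    · intro h
      ext X
      have := DFunLike.congr_fun h X
      simpa [stdAddChar_eq_one_iff] using! this
    · rintro rfl
      ext X
      simp
  simp only [h2] at h
  exact h

theorem sum_stdAddChar_mul (a : ZMod p) :
    ∑ s, stdAddChar (s * a) = if a = 0 then (p : ℂ) else 0 := by
  classical
  have h := sum_stdAddChar_linear ((LinearMap.id (R := ZMod p) (M := ZMod p)).smulRight a)
  have h2 : (LinearMap.id (R := ZMod p) (M := ZMod p)).smulRight a = 0 ↔ a = 0 := by
    constructor
    · intro h
      simpa using DFunLike.congr_fun h 1
    · rintro rfl; simp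
  simpa only [h2, LinearMap.smulRight_apply, LinearMap.id_apply, smul_eq_mul, ZMod.card] using h

theorem sum_stdAddChar_mul_ne_zero {a : ZMod p} (ha : a ≠ 0) :
    ∑ s with s ≠ 0, stdAddChar (s * a) = (-1 : ℂ) := by
  have h := sum_stdAddChar_mul a
  rw [if_neg ha, ← Finset.sum_filter_add_sum_filter_not univ (fun s : ZMod p => s ≠ 0)] at h
  simp only [ne_eq, not_not] at h ⊢
  rw [Finset.sum_filter (fun s : ZMod p => s = 0)] at h
  simp at h
  linear_combination h

theorem card_ne_zero_zmod : (#{s : ZMod p | s ≠ 0} : ℂ) = p - 1 := by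
  rw [Finset.filter_ne', Finset.card_erase_of_mem (mem_univ _), Finset.card_univ, ZMod.card,
    Nat.cast_sub (Fact.out : p.Prime).one_le, Nat.cast_one]

theorem mul_card_zeros {T : Type*} [Fintype T] (f : T → ZMod p) :
    (p : ℂ) * #{X | f X = 0} = ∑ s, ∑ X, stdAddChar (s * f X) := by
  rw [Finset.sum_comm]
  simp only [sum_stdAddChar_mul]
  rw [← Finset.sum_filter, Finset.sum_const, nsmul_eq_mul, mul_comm]

theorem mul_card_common_zeros {T : Type*} [Fintype T] (f g : T → ZMod p) :
    (p : ℂ) ^ 2 * #{X | f X = 0 ∧ g X = 0} =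
      ∑ s, ∑ t, ∑ X, stdAddChar (s * f X + t * g X) := by
  have h (X : T) : ∑ s, ∑ t, stdAddChar (s * f X + t * g X) =
      if f X = 0 ∧ g X = 0 then (p : ℂ) ^ 2 else 0 := by
    simp only [AddChar.map_add_eq_mul, ← Finset.mul_sum, ← Finset.sum_mul, sum_stdAddChar_mul]
    by_cases h1 : f X = 0 <;> by_cases h2 : g X = 0 <;> simp [h1, h2, sq]
  rw [Finset.sum_congr rfl fun s _ => Finset.sum_comm, Finset.sum_comm]
  simp only [h]
  rw [← Finset.sum_filter, Finset.sum_const, nsmul_eq_mul, mul_comm]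

theorem sum_eq_zero_add_sum_ne_zero (f : ZMod p → ℂ) :
    ∑ s, f s = f 0 + ∑ s with s ≠ 0, f s := by
  rw [Finset.filter_ne', Finset.add_sum_erase _ _ (mem_univ _)]

section QuadraticForm

variable (B : LinearMap.BilinForm (ZMod p) V)

/-- Substituting `X = w + Y` makes the sum over `Y` a linear character sum, which vanishes unless
`w` lies in the radical; there `B w w = 0` since `p` is odd. -/
theorem gauss_sum_mul_gauss_sum_neg (hp : p ≠ 2) :
    (∑ X, stdAddChar (B X X)) * ∑ X, stdAddChar (-(B X X)) =
      (Fintype.card V * Nat.card (LinearMap.ker (B + B.flip)) : ℂ) := by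
  classical
  have h2 : (2 : ZMod p) ≠ 0 := by
    have : Fact (2 < p) := ⟨lt_of_le_of_ne (Fact.out : p.Prime).two_le hp.symm⟩
    exact Ring.two_ne_zero (by rwa [ZMod.ringChar_zmod_n])
  have key (w : V) : ∑ Y, stdAddChar (B (w + Y) (w + Y)) * stdAddChar (-(B Y Y)) =
      if w ∈ LinearMap.ker (B + B.flip) then (Fintype.card V : ℂ) else 0 := by
    have h := sum_stdAddChar_linear ((B + B.flip) w)
    have : ∀ Y, (stdAddChar (B (w + Y) (w + Y)) * stdAddChar (-(B Y Y)) : ℂ) =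
        stdAddChar (B w w) * stdAddChar ((B + B.flip) w Y) := by
      intro Y
      rw [← AddChar.map_add_eq_mul, ← AddChar.map_add_eq_mul]
      congr 1
      simp
      ring
    simp only [this, ← Finset.mul_sum, h, LinearMap.mem_ker]
    split_ifs with hw
    · have h0 := DFunLike.congr_fun hw w
      have : B w w = 0 := by
        have : 2 * B w w = 0 := by simpa [two_mul] using h0
        exact (mul_eq_zero.1 this).resolve_left h2
      simp [this]
    · simp
  rw [Finset.sum_mul_sum, Finset.sum_comm]
  have (Y : V) : ∑ X, (stdAddChar (B X X) * stdAddChar (-(B Y Y)) : ℂ) =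
      ∑ w, stdAddChar (B (w + Y) (w + Y)) * stdAddChar (-(B Y Y)) :=
    (Equiv.sum_comp (Equiv.addRight Y)
      fun X => (stdAddChar (B X X) * stdAddChar (-(B Y Y)) : ℂ)).symm
  simp only [this]
  rw [Finset.sum_comm]
  simp only [key]
  rw [← Finset.sum_filter, Finset.sum_const, nsmul_eq_mul, mul_comm, ← Fintype.card_subtype,
    ← Nat.card_eq_fintype_card (α := {x // x ∈ LinearMap.ker (B + B.flip)})]

/-- Completing the square: translate `X` by `(t / s) • w`. -/
theorem sum_shifted_gauss_sum {s : ZMod p} (hs : s ≠ 0) (t : ZMod p) (w : V) :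
    ∑ X, stdAddChar (s * B X X + t * (B + B.flip) w X) =
      stdAddChar (-(t ^ 2 * (s⁻¹ * B w w))) * (∑ X, stdAddChar (s * B X X) : ℂ) := by
  rw [← Equiv.sum_comp (Equiv.addRight ((t / s) • w)) fun X => (stdAddChar (s * B X X) : ℂ),
    Finset.mul_sum]
  refine Finset.sum_congr rfl fun X _ => ?_
  rw [← AddChar.map_add_eq_mul]
  congr 1
  simp
  field_simp
  ring

theorem range_eq_dualAnnihilator_ker :
    LinearMap.range (B + B.flip) = (LinearMap.ker (B + B.flip)).dualAnnihilator := by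
  apply Submodule.eq_of_le_of_finrank_eq
  · rintro _ ⟨w, rfl⟩
    rw [Submodule.mem_dualAnnihilator]
    intro r hr
    have := DFunLike.congr_fun (LinearMap.mem_ker.1 hr) w
    simp at this ⊢
    rw [add_comm]; exact this
  · have h1 := Subspace.finrank_add_finrank_dualAnnihilator_eq (LinearMap.ker (B + B.flip))
    have h2 := LinearMap.finrank_range_add_finrank_ker (B + B.flip)
    exact Nat.add_left_cancel (((add_comm _ _).trans h2).trans h1.symm)

/-- Some radical vector `r` has `l r ≠ 0`; translation by `r` multiplies the sum by a character
value different from `1`. -/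
theorem sum_gauss_sum_eq_zero_of_notMem_range (hp : p ≠ 2) {l : Module.Dual (ZMod p) V}
    (hl : l ∉ LinearMap.range (B + B.flip)) (s : ZMod p) {t : ZMod p} (ht : t ≠ 0) :
    ∑ X, stdAddChar (s * B X X + t * l X) = (0 : ℂ) := by
  have h2 : (2 : ZMod p) ≠ 0 := by
    exact Ring.two_ne_zero (by rwa [ZMod.ringChar_zmod_n])
  rw [range_eq_dualAnnihilator_ker, Submodule.mem_dualAnnihilator] at hl
  push Not at hl
  obtain ⟨r, hr, hlr⟩ := hl
  rw [LinearMap.mem_ker] at hr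
  have hrr : B r r = 0 := by
    have : 2 * B r r = 0 := by simpa [two_mul] using DFunLike.congr_fun hr r
    exact (mul_eq_zero.1 this).resolve_left h2
  have h := Equiv.sum_comp (Equiv.addRight r) fun X => (stdAddChar (s * B X X + t * l X) : ℂ)
  have h3 : ∀ X, (stdAddChar (s * B ((Equiv.addRight r) X) ((Equiv.addRight r) X) +
      t * l ((Equiv.addRight r) X)) : ℂ) =
      stdAddChar (t * l r) * stdAddChar (s * B X X + t * l X) := by
    intro X
    have h4 := DFunLike.congr_fun hr X
    simp at h4
    rw [← AddChar.map_add_eq_mul]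
    congr 1
    simp
    linear_combination s * h4 + s * hrr
  simp only [h3, ← Finset.mul_sum] at h
  have h5 : (stdAddChar (t * l r) : ℂ) - 1 ≠ 0 := by
    rw [sub_ne_zero, ne_eq, stdAddChar_eq_one_iff]
    exact mul_ne_zero ht hlr
  have h6 : ((stdAddChar (t * l r) : ℂ) - 1) * ∑ X, stdAddChar (s * B X X + t * l X) = 0 := by
    linear_combination h
  exact (mul_eq_zero.1 h6).resolve_left h5

end QuadraticForm

end CharacterSums

/-! ### Zeros of a quadratic form on hyperplanes, and sizes of classes of functionals. -/

section Counting

open Finset ZMod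

/-- `S` is a union of cosets of the kernel, and these cosets are the fibres of `f` on `S`. -/
theorem card_ker_mul_ncard_image {K V W : Type*} [Field K] [AddCommGroup V] [Module K V]
    [AddCommGroup W] [Module K W] [Finite V] (f : V →ₗ[K] W) (S : Set V)
    (hS : ∀ x ∈ S, ∀ r ∈ LinearMap.ker f, x + r ∈ S) :
    Nat.card (LinearMap.ker f) * (f '' S).ncard = S.ncard := by
  classical
  have := Fintype.ofFinite V
  have h := Finset.card_eq_sum_card_image f S.toFinset
  rw [Set.ncard_eq_toFinset_card' S, h, Finset.sum_congr rfl
    (g := fun _ => Nat.card (LinearMap.ker f)), Finset.sum_const, smul_eq_mul, mul_comm,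
    ← Set.toFinset_image, ← Set.ncard_eq_toFinset_card']
  intro y hy
  obtain ⟨w, hw, rfl⟩ := Finset.mem_image.1 hy
  rw [Set.mem_toFinset] at hw
  rw [Nat.card_eq_fintype_card, Fintype.card_subtype]
  refine Finset.card_bij' (fun x _ => x - w) (fun x _ => w + x) ?_ ?_ ?_ ?_
  · intro x hx
    simp only [Finset.mem_filter, Set.mem_toFinset] at hx
    simp [hx.2]
  · intro x hx
    simp only [Finset.mem_filter, Finset.mem_univ, true_and] at hx
    simp only [Finset.mem_filter, Set.mem_toFinset]
    exact ⟨hS w hw x hx, by simpa using hx⟩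
  · simp
  · simp

variable {p : ℕ} [Fact p.Prime] {V : Type*} [AddCommGroup V] [Module (ZMod p) V] [Fintype V]
  {B : LinearMap.BilinForm (ZMod p) V} {g : ℤ}

theorem mul_card_isotropic (hg : ∀ s : ZMod p, s ≠ 0 → ∑ X, stdAddChar (s * B X X) = (g : ℂ)) :
    (p : ℤ) * #{X | B X X = 0} = Fintype.card V + (p - 1) * g := by
  have h := mul_card_zeros fun X => B X X
  rw [sum_eq_zero_add_sum_ne_zero,
    Finset.sum_congr (f := fun s => ∑ X, stdAddChar (s * B X X)) rfl
      (fun s hs => hg s (Finset.mem_filter.1 hs).2), Finset.sum_const, nsmul_eq_mul,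
    card_ne_zero_zmod] at h
  simp at h
  exact_mod_cast h

/-- Only the terms `t = 0` of the double character sum survive, so the hyperplane `l = 0` contains
exactly a fraction `1 / p` of the zeros. -/
theorem mul_card_isotropic_of_notMem_range (hp : p ≠ 2)
    (hg : ∀ s : ZMod p, s ≠ 0 → ∑ X, stdAddChar (s * B X X) = (g : ℂ))
    {l : Module.Dual (ZMod p) V} (hl : l ∉ LinearMap.range (B + B.flip)) :
    (p : ℤ) ^ 2 * #{X | B X X = 0 ∧ l X = 0} = Fintype.card V + (p - 1) * g := by
  have h := mul_card_common_zeros (fun X => B X X) l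
  have h2 (s : ZMod p) : ∑ t, ∑ X, stdAddChar (s * B X X + t * l X) =
      (∑ X, stdAddChar (s * B X X) : ℂ) := by
    rw [sum_eq_zero_add_sum_ne_zero, Finset.sum_eq_zero (s := {t | t ≠ 0})
      fun t ht => sum_gauss_sum_eq_zero_of_notMem_range B hp hl s (Finset.mem_filter.1 ht).2]
    simp
  simp only [h2] at h
  rw [← mul_card_zeros] at h
  have h3 := mul_card_isotropic hg
  rw [← h3]
  exact_mod_cast h

theorem mul_card_isotropic_of_range
    (hg : ∀ s : ZMod p, s ≠ 0 → ∑ X, stdAddChar (s * B X X) = (g : ℂ)) {w : V}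
    (hw : (B + B.flip) w ≠ 0) :
    (p : ℤ) ^ 2 * #{X | B X X = 0 ∧ (B + B.flip) w X = 0} =
      Fintype.card V + if B w w = 0 then p * (p - 1) * g else 0 := by
  classical
  have h := mul_card_common_zeros (fun X => B X X) ((B + B.flip) w)
  have h0 : ∑ t : ZMod p, ∑ X, stdAddChar (0 * B X X + t * (B + B.flip) w X) =
      (Fintype.card V : ℂ) := by
    rw [sum_eq_zero_add_sum_ne_zero, Finset.sum_eq_zero (s := {t | t ≠ 0})]
    · simp
    · intro t ht
      have h1 := sum_stdAddChar_linear (t • (B + B.flip) w)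
      rw [if_neg (smul_ne_zero (Finset.mem_filter.1 ht).2 hw)] at h1
      simpa [mul_add] using! h1
  have h1 (s : ZMod p) (hs : s ∈ ({s | s ≠ 0} : Finset (ZMod p))) :
      ∑ t, ∑ X, stdAddChar (s * B X X + t * (B + B.flip) w X) =
        (g * ∑ t : ZMod p, stdAddChar (t ^ 2 * -(s⁻¹ * B w w)) : ℂ) := by
    have hs := (Finset.mem_filter.1 hs).2
    simp only [sum_shifted_gauss_sum B hs, hg s hs, ← Finset.sum_mul]
    rw [mul_comm]
    simp only [mul_neg]
  rw [sum_eq_zero_add_sum_ne_zero, h0, Finset.sum_congr rfl h1, ← Finset.mul_sum] at h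
  have h2 : ∑ s : ZMod p with s ≠ 0, ∑ t : ZMod p, stdAddChar (t ^ 2 * -(s⁻¹ * B w w)) =
      (if B w w = 0 then p * (p - 1) else 0 : ℂ) := by
    split_ifs with hB
    · simp only [hB, mul_zero, neg_zero, AddChar.map_zero_eq_one, Finset.sum_const, nsmul_eq_mul,
        card_ne_zero_zmod, Finset.card_univ, ZMod.card]
      ring
    -- Summing over `s` first avoids a quadratic Gauss sum in `t`: after `s ↦ s⁻¹` each `t ≠ 0`
    -- contributes `-1`, cancelling the `p - 1` from `t = 0`.
    · rw [Finset.sum_comm, sum_eq_zero_add_sum_ne_zero]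
      have h3 (t : ZMod p) (ht : t ∈ ({s | s ≠ 0} : Finset (ZMod p))) :
          ∑ s : ZMod p with s ≠ 0, stdAddChar (t ^ 2 * -(s⁻¹ * B w w)) = (-1 : ℂ) := by
        have ht := (Finset.mem_filter.1 ht).2
        have ha : -(t ^ 2 * B w w) ≠ 0 := neg_ne_zero.2 (mul_ne_zero (pow_ne_zero 2 ht) hB)
        rw [← sum_stdAddChar_mul_ne_zero ha]
        refine Finset.sum_bij' (fun s _ => s⁻¹) (fun s _ => s⁻¹) ?_ ?_ ?_ ?_ ?_
        · simp
        · simp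
        · simp
        · simp
        · intro s _
          congr 1
          ring
      rw [Finset.sum_congr rfl h3, Finset.sum_const, nsmul_eq_mul, card_ne_zero_zmod]
      simp only [ne_eq, OfNat.ofNat_ne_zero, not_false_eq_true, zero_pow, zero_mul,
        AddChar.map_zero_eq_one, Finset.sum_const, nsmul_eq_mul, card_ne_zero_zmod]
      ring
  rw [h2] at h
  have h4 : ((if B w w = 0 then p * (p - 1) * g else 0 : ℤ) : ℂ) =
      g * (if B w w = 0 then p * (p - 1) else 0 : ℂ) := by
    split_ifs <;> push_cast <;> ring
  rw [← h4] at h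
  exact_mod_cast h

omit [Fintype V] in
theorem isotropic_add_mem_ker (hp : p ≠ 2) (w : V) {r : V}
    (hr : r ∈ LinearMap.ker (B + B.flip)) : B (w + r) (w + r) = B w w := by
  have h2 : (2 : ZMod p) ≠ 0 := Ring.two_ne_zero (by rwa [ZMod.ringChar_zmod_n])
  have hr' (x : V) : B r x + B x r = 0 := by
    simpa using DFunLike.congr_fun (LinearMap.mem_ker.1 hr) x
  have hrr : B r r = 0 := by
    have : 2 * B r r = 0 := by simpa [two_mul] using hr' r
    exact (mul_eq_zero.1 this).resolve_left h2
  simp only [map_add, LinearMap.add_apply]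
  linear_combination hr' w + hrr

variable (B)

theorem card_ker_mul_ncard_isotropic (hp : p ≠ 2) :
    Nat.card (LinearMap.ker (B + B.flip)) * ((B + B.flip) '' {w | B w w = 0}).ncard =
      #{X | B X X = 0} := by
  rw [card_ker_mul_ncard_image]
  · rw [Set.ncard_eq_toFinset_card']
    simp
  · intro w hw r hr
    exact (isotropic_add_mem_ker hp w hr).trans hw

theorem card_ker_mul_ncard_anisotropic (hp : p ≠ 2) :
    Nat.card (LinearMap.ker (B + B.flip)) * ((B + B.flip) '' {w | B w w ≠ 0}).ncard +
      #{X | B X X = 0} = Fintype.card V := by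
  rw [card_ker_mul_ncard_image]
  · rw [Set.ncard_eq_toFinset_card', Set.toFinset_ofPred, add_comm,
      Finset.card_filter_add_card_filter_not, Finset.card_univ]
  · intro w hw r hr
    simpa only [Set.mem_ofPred_eq, isotropic_add_mem_ker hp w hr] using hw

theorem card_ker_mul_ncard_range_compl :
    Nat.card (LinearMap.ker (B + B.flip)) *
      (LinearMap.range (B + B.flip) : Set (Module.Dual (ZMod p) V))ᶜ.ncard + Fintype.card V =
      Nat.card (LinearMap.ker (B + B.flip)) * Fintype.card V := by
  have : Finite (Module.Dual (ZMod p) V) := Module.finite_of_finite (ZMod p)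
  have h := card_ker_mul_ncard_image (B + B.flip) Set.univ (by simp)
  rw [Set.image_univ, Set.ncard_univ, Nat.card_eq_fintype_card (α := V)] at h
  have h2 := Set.ncard_add_ncard_compl (Set.range (B + B.flip))
  have h3 : Nat.card (Module.Dual (ZMod p) V) = Fintype.card V := by
    rw [Module.natCard_eq_pow_finrank (K := ZMod p), Subspace.dual_finrank_eq,
      ← Module.natCard_eq_pow_finrank, Nat.card_eq_fintype_card]
  rw [LinearMap.coe_range]
  have h4 := congrArg (Nat.card (LinearMap.ker (B + B.flip)) * ·) (h2.trans h3)
  simp only [mul_add, h] at h4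
  rw [← h4, add_comm]

end Counting

/-! ### Power equations and Frobenius equations in a finite field. -/

section FiniteFieldPowers

open Finset

variable {F : Type*} [Field F] [Fintype F]

theorem exists_pow_eq_of_pow_eq_one {k j : ℕ} (h : k * j = Fintype.card F - 1) {x : F}
    (hx : x ≠ 0) (hxj : x ^ j = 1) : ∃ c : F, c ≠ 0 ∧ c ^ k = x := by
  classical
  obtain ⟨g, hg⟩ := IsCyclic.exists_generator (α := Fˣ)
  have ho : orderOf g = k * j := by
    rw [orderOf_eq_card_of_forall_mem_zpowers hg, Nat.card_eq_fintype_card, Fintype.card_units, h]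
  have hpos : 0 < k * j := by
    rw [h]; exact Nat.sub_pos_of_lt Fintype.one_lt_card
  obtain ⟨n, hn⟩ := mem_powers_iff_mem_zpowers.2 (hg (Units.mk0 x hx))
  simp only at hn
  have h1 : g ^ (n * j) = 1 := by
    rw [pow_mul, hn]
    ext
    simpa using hxj
  have h2 : k ∣ n := by
    have := orderOf_dvd_of_pow_eq_one h1
    rw [ho] at this
    exact Nat.dvd_of_mul_dvd_mul_right (pos_of_mul_pos_right hpos (Nat.zero_le _)) this
  obtain ⟨i, rfl⟩ := h2
  refine ⟨(g ^ i : Fˣ), Units.ne_zero _, ?_⟩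
  rw [← Units.val_pow_eq_pow_val, ← pow_mul, mul_comm, hn, Units.val_mk0]

theorem card_pow_eq_one [DecidableEq F] {k j : ℕ} (h : k * j = Fintype.card F - 1) :
    #{c : F | c ^ k = 1} = k := by
  classical
  have hpos : 0 < k * j := by
    rw [h]; exact Nat.sub_pos_of_lt Fintype.one_lt_card
  have hk : 0 < k := pos_of_mul_pos_left hpos (Nat.zero_le _)
  obtain ⟨g, hg⟩ := IsCyclic.exists_generator (α := Fˣ)
  have ho : orderOf g = k * j := by
    rw [orderOf_eq_card_of_forall_mem_zpowers hg, Nat.card_eq_fintype_card, Fintype.card_units, h]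
  have hprim : IsPrimitiveRoot (g : F) (k * j) := by
    rw [IsPrimitiveRoot.coe_units_iff, ← ho]
    exact IsPrimitiveRoot.orderOf g
  have h2 := (hprim.pow hpos (mul_comm k j)).card_nthRootsFinset
  rw [← h2]
  congr 1
  ext c
  rw [Polynomial.mem_nthRootsFinset hk]
  simp only [Finset.mem_filter, Finset.mem_univ, true_and]
  rw [h2]

/-- The fibres of `y ↦ y ^ k` on `S` are free orbits of the group of `k`-th roots of unity, which
has order `k`. -/
theorem dvd_card_of_mul_invariant [DecidableEq F] {k j : ℕ} (h : k * j = Fintype.card F - 1)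
    (S : Finset F) (h0 : 0 ∉ S) (hS : ∀ y ∈ S, ∀ c : F, c ^ k = 1 → c * y ∈ S) : k ∣ #S := by
  have hpos : 0 < k * j := by
    rw [h]; exact Nat.sub_pos_of_lt Fintype.one_lt_card
  have hk : k ≠ 0 := (pos_of_mul_pos_left hpos (Nat.zero_le _)).ne'
  rw [Finset.card_eq_sum_card_image (fun y => y ^ k) S]
  refine Finset.dvd_sum fun z hz => ?_
  obtain ⟨y, hy, rfl⟩ := Finset.mem_image.1 hz
  have hy0 : y ≠ 0 := fun h => h0 (h ▸ hy)
  refine dvd_of_eq ((card_pow_eq_one h).symm.trans ?_)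
  refine Finset.card_bij' (fun c _ => c * y) (fun x _ => x / y) ?_ ?_ ?_ ?_
  · intro c hc
    have hc := (Finset.mem_filter.1 hc).2
    simp only [Finset.mem_filter]
    exact ⟨hS y hy c hc, by rw [mul_pow, hc, one_mul]⟩
  · intro x hx
    have hx := (Finset.mem_filter.1 hx).2
    simp only [Finset.mem_filter, Finset.mem_univ, true_and]
    rw [div_pow, hx, div_self (pow_ne_zero k hy0)]
  · intro c _; field_simp
  · intro c _; field_simp

omit [Fintype F] in
theorem pow_pow_mul_eq_self {p n : ℕ} {x : F} (h : x ^ p ^ n = x) (j : ℕ) :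
    x ^ p ^ (n * j) = x := by
  induction j with
  | zero => simp
  | succ j ih => rw [mul_add, mul_one, pow_add, pow_mul, ih, h]

/-- Periods of `z` under Frobenius are closed under gcd, and `m` is always one. -/
theorem pow_gcd_eq_self {p a m : ℕ} (hF : Fintype.card F = p ^ m) {z : F} (hz : z ^ p ^ a = z) :
    z ^ p ^ (Nat.gcd m a) = z := by
  have h (n : ℕ) : Function.IsPeriodicPt (fun x : F => x ^ p) n z ↔ z ^ p ^ n = z := by
    rw [Function.IsPeriodicPt, Function.IsFixedPt, pow_iterate]
  rw [← h] at hz ⊢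
  exact ((h m).2 (by rw [← hF, FiniteField.pow_card])).gcd hz

variable {p : ℕ} [Fact p.Prime]

omit [Fintype F] in
theorem pow_odd_mul_of_pow_eq_neg (hp : p ≠ 2) {n : ℕ} {y : F} (hy : y ^ p ^ n = -y) (j : ℕ) :
    y ^ p ^ (n * (2 * j + 1)) = -y := by
  have hodd : Odd p := (Fact.out : p.Prime).odd_of_ne_two hp
  have h1 : y ^ p ^ (n * 2) = y := by
    rw [mul_two, pow_add, pow_mul, hy, hodd.pow.neg_pow, hy, neg_neg]
  rw [show n * (2 * j + 1) = n * 2 * j + n by ring, pow_add, pow_mul, pow_pow_mul_eq_self h1, hy]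

/-- `-1` is a `(p ^ n - 1)`-th power: the cofactor of `p ^ n - 1` in `p ^ m - 1` contains the even
factor `(p ^ n) ^ e + 1`. -/
theorem exists_pow_eq_neg {n m e : ℕ} (hm : m = n * (2 * e))
    (hp : p ≠ 2) (hF : Fintype.card F = p ^ m) : ∃ c : F, c ≠ 0 ∧ c ^ p ^ n = -c := by
  have hodd : Odd p := (Fact.out : p.Prime).odd_of_ne_two hp
  obtain ⟨b, hb⟩ := Nat.sub_one_dvd_pow_sub_one (p ^ n) e
  obtain ⟨d, hd⟩ := (hodd.pow (n := n)).pow (n := e) |>.add_one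
  have h1 : (p ^ n - 1) * (2 * (b * d)) = Fintype.card F - 1 := by
    rw [hF, hm, pow_mul, mul_comm 2 e, pow_mul]
    have := Nat.sq_sub_sq ((p ^ n) ^ e) 1
    rw [one_pow] at this
    rw [this, hb, hd]
    ring
  obtain ⟨c, hc, hcs⟩ := exists_pow_eq_of_pow_eq_one (x := (-1 : F)) h1 (by simp)
    (by rw [pow_mul]; simp)
  refine ⟨c, hc, ?_⟩
  rw [← Nat.sub_add_cancel (Nat.one_le_pow n p (Fact.out : p.Prime).pos), pow_succ, hcs,
    neg_one_mul]

theorem card_pow_eq_self [DecidableEq F] {n m e : ℕ} (hm : m = n * e)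
    (hF : Fintype.card F = p ^ m) : #{z : F | z ^ p ^ n = z} = p ^ n := by
  have hpos : 1 ≤ p ^ n := Nat.one_le_pow n p (Fact.out : p.Prime).pos
  obtain ⟨b, hb⟩ := Nat.sub_one_dvd_pow_sub_one (p ^ n) e
  have h1 : (p ^ n - 1) * b = Fintype.card F - 1 := by
    rw [hF, hm, pow_mul, hb]
  have hpos2 : p ^ n - 1 ≠ 0 := by
    intro h
    rw [h, zero_mul] at h1
    exact (Nat.sub_pos_of_lt (Fintype.one_lt_card (α := F))).ne h1
  have h2 := card_pow_eq_one h1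
  have h3 : ({z : F | z ^ p ^ n = z} : Finset F) =
      insert 0 ({z : F | z ^ (p ^ n - 1) = 1} : Finset F) := by
    ext z
    simp only [Finset.mem_filter, Finset.mem_univ, true_and, Finset.mem_insert]
    by_cases hz : z = 0
    · simp [hz, (Fact.out : p.Prime).ne_zero]
    · nth_rw 1 [← Nat.sub_add_cancel hpos]
      rw [pow_succ]
      simp [hz]
  rw [h3, Finset.card_insert_of_notMem (by simp [hpos2]), h2, Nat.sub_add_cancel hpos]

/-- Dividing by one solution `c` of `c ^ p ^ n = -c` turns the equation into a Frobenius fixed-point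
equation. -/
theorem card_pow_eq_neg [DecidableEq F] (hp : p ≠ 2) {n m e j : ℕ} (hm : m = n * (2 * e))
    (hgcd : Nat.gcd m (n * (2 * j + 1)) = n) (hF : Fintype.card F = p ^ m) :
    #{y : F | y ^ p ^ (n * (2 * j + 1)) = -y} = p ^ n := by
  obtain ⟨c, hc, hcn⟩ := exists_pow_eq_neg hm hp hF
  have hcj := pow_odd_mul_of_pow_eq_neg hp hcn j
  rw [← card_pow_eq_self hm hF]
  refine Finset.card_bij' (fun y _ => y / c) (fun z _ => z * c) ?_ ?_ ?_ ?_
  · intro y hy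
    simp only [Finset.mem_filter, Finset.mem_univ, true_and] at hy ⊢
    rw [← hgcd]
    apply pow_gcd_eq_self hF
    rw [div_pow, hcj, hy, neg_div_neg_eq]
  · intro z hz
    simp only [Finset.mem_filter, Finset.mem_univ, true_and] at hz ⊢
    rw [mul_pow, hcj, pow_pow_mul_eq_self hz, mul_neg]
  · intro c _; field_simp
  · intro c _; field_simp

variable [Algebra (ZMod p) F]

omit [Fintype F] in
theorem algebraMap_pow_pow (s : ZMod p) (n : ℕ) :
    algebraMap (ZMod p) F s ^ p ^ n = algebraMap (ZMod p) F s := by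
  rw [← map_pow, ZMod.pow_card_pow]

omit [Fintype F] in
-- Applying the `v`-th Frobenius iterate to `hc` shows that `c` is fixed by the `2 * v`-th, so only
-- the parity of the multiple of `v` matters.
theorem pow_odd_mul_of_pow_mul {v : ℕ} {s : ZMod p} {c : F} (hc0 : c ≠ 0)
    (hc : c * c ^ p ^ v = algebraMap (ZMod p) F s) (j : ℕ) :
    c * c ^ p ^ (v * (2 * j + 1)) = algebraMap (ZMod p) F s := by
  have h1 : c ^ p ^ (v * 2) = c := by
    have h2 := congrArg (· ^ p ^ v) hc
    simp only [mul_pow, algebraMap_pow_pow] at h2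
    rw [← hc, mul_comm c] at h2
    rw [mul_two, pow_add, pow_mul]
    exact mul_left_cancel₀ (pow_ne_zero _ hc0) h2
  have h3 := pow_pow_mul_eq_self h1 j
  rw [show v * (2 * j + 1) = v * 2 * j + v by ring, pow_add, pow_mul, h3, hc]

/-- `p - 1` divides `(p ^ m - 1) / (p ^ v + 1)`, so every nonzero scalar is a `(p ^ v + 1)`-th
power. -/
theorem exists_mul_pow_eq_algebraMap {v m e : ℕ} (hm : m = 2 * v * e)
    (hF : Fintype.card F = p ^ m) {s : ZMod p} (hs : s ≠ 0) :
    ∃ c : F, c ≠ 0 ∧ c * c ^ p ^ v = algebraMap (ZMod p) F s := by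
  have hp1 : 1 ≤ p := (Fact.out : p.Prime).one_le
  obtain ⟨a, ha⟩ := Nat.sub_one_dvd_pow_sub_one p v
  obtain ⟨b, hb⟩ := Nat.sub_one_dvd_pow_sub_one (p ^ (2 * v)) e
  have h1 : (p ^ v + 1) * ((p - 1) * (a * b)) = Fintype.card F - 1 := by
    rw [hF, hm, pow_mul, hb, ← mul_assoc (p - 1), ← ha, mul_comm 2 v, pow_mul, ← mul_assoc]
    congr 1
    exact (Nat.sq_sub_sq (p ^ v) 1).symm
  obtain ⟨c, hc, hcs⟩ := exists_pow_eq_of_pow_eq_one (x := algebraMap (ZMod p) F s) h1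
    (by simpa using hs) (by rw [pow_mul, ← map_pow, ZMod.pow_card_sub_one_eq_one hs]; simp)
  exact ⟨c, hc, by rw [← hcs]; ring⟩

end FiniteFieldPowers

/-! ### The form `Tr (x * y ^ p ^ u)`: its radical and its Gauss sums. -/

section FrobeniusForm

open Finset ZMod

variable {p : ℕ} [Fact p.Prime] {F : Type*} [Field F] [Algebra (ZMod p) F]

variable (p F) in
/-- The bilinear form `(x, y) ↦ Tr (x * y ^ p ^ u)`. -/
noncomputable def frobeniusForm (u : ℕ) : LinearMap.BilinForm (ZMod p) F :=
  (Algebra.traceForm (ZMod p) F).compRight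
    ((FiniteField.frobeniusAlgHom (ZMod p) F) ^ u).toLinearMap

theorem frobeniusAlgHom_pow_apply (u : ℕ) (y : F) :
    ((FiniteField.frobeniusAlgHom (ZMod p) F) ^ u) y = y ^ p ^ u := by
  induction u with
  | zero => simp
  | succ u ih => rw [pow_succ', AlgHom.mul_apply, ih, FiniteField.frobeniusAlgHom_apply, ZMod.card,
      ← pow_mul, pow_succ]

theorem frobeniusForm_apply (u : ℕ) (x y : F) :
    frobeniusForm p F u x y = Algebra.trace (ZMod p) F (x * y ^ p ^ u) := by
  rw [← frobeniusAlgHom_pow_apply u y]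
  rfl

variable (F) in
theorem two_ne_zero_of_algebra_zmod (hp : p ≠ 2) : (2 : F) ≠ 0 := by
  intro h
  have h2 : (2 : ZMod p) ≠ 0 := Ring.two_ne_zero (by rwa [ZMod.ringChar_zmod_n])
  exact h2 ((algebraMap (ZMod p) F).injective (by rw [map_ofNat, map_zero, h]))

theorem trace_algebraMap_mul (s : ZMod p) (x : F) :
    Algebra.trace (ZMod p) F (algebraMap (ZMod p) F s * x) =
      s * Algebra.trace (ZMod p) F x := by
  rw [← Algebra.smul_def, _root_.map_smul, smul_eq_mul]

theorem frobeniusForm_mul {u : ℕ} {c : F} {s : ZMod p}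
    (hc : c * c ^ p ^ u = algebraMap (ZMod p) F s) (y : F) :
    frobeniusForm p F u (c * y) (c * y) = s * frobeniusForm p F u y y := by
  rw [frobeniusForm_apply, frobeniusForm_apply, ← trace_algebraMap_mul, ← hc]
  congr 1
  ring

variable [Fintype F]

theorem trace_pow_pow (u : ℕ) (x : F) :
    Algebra.trace (ZMod p) F (x ^ p ^ u) = Algebra.trace (ZMod p) F x := by
  induction u with
  | zero => simp
  | succ u ih =>
    rw [pow_succ, pow_mul, ← ih]
    have h := Algebra.trace_eq_of_algEquiv
      (FiniteField.frobeniusAlgEquivOfAlgebraic (ZMod p) F) (x ^ p ^ u)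
    rw [← h, FiniteField.coe_frobeniusAlgEquivOfAlgebraic, ZMod.card]

theorem trace_mul_eq_zero {a : F} (h : ∀ x : F, Algebra.trace (ZMod p) F (a * x) = 0) : a = 0 :=
  (traceForm_nondegenerate (ZMod p) F).1 a h

/-- Frobenius invariance of the trace gathers the polar form into one trace pairing with `z ^ p ^
u`, which runs over all of `F`; nondegeneracy then applies. -/
theorem mem_ker_frobeniusForm {u : ℕ} {y : F} :
    y ∈ LinearMap.ker (frobeniusForm p F u + (frobeniusForm p F u).flip) ↔
      y ^ p ^ (2 * u) = -y := by
  have h (z : F) : (frobeniusForm p F u + (frobeniusForm p F u).flip) y z =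
      Algebra.trace (ZMod p) F ((y ^ p ^ (2 * u) + y) * z ^ p ^ u) := by
    simp only [LinearMap.add_apply, LinearMap.BilinForm.flip_apply, frobeniusForm_apply]
    rw [← trace_pow_pow u (z * y ^ p ^ u), ← map_add]
    congr 1
    rw [mul_pow, ← pow_mul, ← pow_add, ← two_mul]
    ring
  rw [LinearMap.mem_ker, eq_neg_iff_add_eq_zero]
  constructor
  · intro hy
    refine trace_mul_eq_zero (p := p) fun x => ?_
    have hbij := Finite.injective_iff_surjective.1
      ((FiniteField.frobeniusAlgHom (ZMod p) F) ^ u).toRingHom.injective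
    obtain ⟨z, hz⟩ := hbij x
    rw [← hz]
    have h2 := h z
    rw [hy, ← frobeniusAlgHom_pow_apply (p := p) u z] at h2
    exact h2.symm
  · intro hy
    ext z
    rw [h, hy]
    simp

/-- Scaling by a suitable `c` multiplies the form by any given `t ≠ 0`, so all nonzero values are
taken equally often and the Gauss sum is `S = #{f = 0} - #{f = 1}` for every `s`. -/
theorem exists_int_frobeniusForm_gauss_sum (hp : p ≠ 2) {m v e u j : ℕ} (hm : m = 2 * v * e)
    (hu : u = v * (2 * j + 1)) (hF : Fintype.card F = p ^ m) :
    ∃ S : ℤ, ((p : ℤ) ^ v + 1) ∣ S - 1 ∧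
      S ^ 2 = p ^ m * Nat.card (LinearMap.ker (frobeniusForm p F u + (frobeniusForm p F u).flip)) ∧
      ∀ s : ZMod p, s ≠ 0 → ∑ y, stdAddChar (s * frobeniusForm p F u y y) = (S : ℂ) := by
  classical
  set f : F → ZMod p := fun y => frobeniusForm p F u y y with hf
  have hmul : ∀ t : ZMod p, t ≠ 0 → ∃ c : F, c ≠ 0 ∧ ∀ y, f (c * y) = t * f y := by
    intro t ht
    obtain ⟨c, hc0, hc⟩ := exists_mul_pow_eq_algebraMap hm hF ht
    exact ⟨c, hc0, frobeniusForm_mul (hu ▸ pow_odd_mul_of_pow_mul hc0 hc j)⟩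
  have hN : ∀ t : ZMod p, t ≠ 0 → #{y | f y = t} = #{y | f y = 1} := by
    intro t ht
    obtain ⟨c, hc0, hc⟩ := hmul t ht
    symm
    refine Finset.card_bij' (fun y _ => c * y) (fun z _ => z / c) ?_ ?_ ?_ ?_
    · intro y hy
      have hy := (Finset.mem_filter.1 hy).2
      simp [hc, hy]
    · intro z hz
      have hz := (Finset.mem_filter.1 hz).2
      have h2 := hc (z / c)
      rw [mul_div_cancel₀ _ hc0, hz] at h2
      simp only [Finset.mem_filter, Finset.mem_univ, true_and]
      exact mul_left_cancel₀ ht (h2.symm.trans (mul_one t).symm)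
    · intro y _; field_simp
    · intro y _; field_simp
  have hsum : ∀ s : ZMod p, s ≠ 0 → ∑ y, stdAddChar (s * f y) =
      (((#{y | f y = 0} : ℤ) - (#{y | f y = 1} : ℤ) : ℤ) : ℂ) := by
    intro s hs
    rw [← Finset.sum_fiberwise (g := f), sum_eq_zero_add_sum_ne_zero]
    have h1 (t : ZMod p) : ∑ y with f y = t, (stdAddChar (s * f y) : ℂ) =
        #{y | f y = t} * stdAddChar (t * s) := by
      rw [Finset.sum_congr rfl (g := fun _ => stdAddChar (t * s)), Finset.sum_const, nsmul_eq_mul]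
      intro y hy
      rw [(Finset.mem_filter.1 hy).2, mul_comm]
    have h2 (t : ZMod p) (ht : t ∈ ({s | s ≠ 0} : Finset (ZMod p))) :
        ∑ y with f y = t, (stdAddChar (s * f y) : ℂ) = #{y | f y = 1} * stdAddChar (t * s) := by
      rw [h1, hN t (Finset.mem_filter.1 ht).2]
    rw [Finset.sum_congr rfl h2, h1, ← Finset.mul_sum, sum_stdAddChar_mul_ne_zero hs]
    push_cast
    simp
    ring
  refine ⟨_, ?_, ?_, hsum⟩
  · have hp1 : 1 ≤ p := (Fact.out : p.Prime).one_le
    obtain ⟨b, hb⟩ := Nat.sub_one_dvd_pow_sub_one (p ^ (2 * v)) e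
    have hk : (p ^ v + 1) * ((p ^ v - 1) * b) = Fintype.card F - 1 := by
      rw [hF, hm, pow_mul, hb, mul_comm 2 v, pow_mul, ← mul_assoc]
      congr 1
      exact (Nat.sq_sub_sq (p ^ v) 1).symm
    have hinv : ∀ c : F, c ^ (p ^ v + 1) = 1 → ∀ y, f (c * y) = f y := by
      intro c hc y
      have hc0 : c ≠ 0 := by
        rintro rfl
        simp at hc
      have h1 : c * c ^ p ^ v = algebraMap (ZMod p) F 1 := by rw [map_one, ← hc]; ring
      have h2 := frobeniusForm_mul (hu ▸ pow_odd_mul_of_pow_mul hc0 h1 j) y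
      rwa [one_mul] at h2
    have hf0 : f 0 = 0 := by simp [hf]
    have d1 := dvd_card_of_mul_invariant hk {y | f y = 1} (by simp [hf0]) (by
      intro y hy c hc
      simpa [hinv c hc] using hy)
    have d0 := dvd_card_of_mul_invariant hk (({y | f y = 0} : Finset F).erase 0) (by simp) (by
      intro y hy c hc
      have hc0 : c ≠ 0 := by
        rintro rfl
        simp at hc
      simpa [hinv c hc, hc0] using hy)
    -- The origin is the one point outside the free orbits; it accounts for the `1` in `S - 1`.
    have h3 : #(({y | f y = 0} : Finset F).erase 0) + 1 = #{y | f y = 0} :=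
      Finset.card_erase_add_one (by simp [hf0])
    zify at d0 d1 h3
    rw [← h3]
    have := dvd_sub d0 d1
    ring_nf at this ⊢
    exact this
  -- The sums at `s = 1` and `s = -1` are both `S`, so their product is `S ^ 2`.
  · have h := gauss_sum_mul_gauss_sum_neg (frobeniusForm p F u) hp
    have h1 := hsum 1 one_ne_zero
    have h2 := hsum (-1) (by simp)
    simp only [one_mul, neg_one_mul] at h1 h2
    simp only [hf] at h1 h2
    rw [h1, h2, hF] at h
    rw [sq]
    exact_mod_cast h

/-- For odd `b`, `p ^ (v * b) ≡ -1` modulo `p ^ v + 1`; the positive root would force `p ^ v + 1 ∣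
2`. -/
theorem eq_neg_pow_of_sq_eq {p v b : ℕ} (hp : 1 < p) (hv : 0 < v) (hb : Odd b) {S : ℤ}
    (hS : ((p : ℤ) ^ v + 1) ∣ S - 1) (hsq : S ^ 2 = ((p : ℤ) ^ (v * b)) ^ 2) :
    S = -(p : ℤ) ^ (v * b) := by
  refine (sq_eq_sq_iff_eq_or_eq_neg.1 hsq).resolve_left ?_
  rintro rfl
  have h1 : ((p : ℤ) ^ v + 1) ∣ (p : ℤ) ^ (v * b) + 1 := by
    have := hb.add_dvd_pow_add_pow ((p : ℤ) ^ v) 1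
    rwa [one_pow, ← pow_mul] at this
  have h2 : ((p : ℤ) ^ v + 1) ∣ 2 := by
    have := dvd_sub h1 hS
    ring_nf at this
    rwa [add_comm] at this
  have h3 := Int.le_of_dvd (by norm_num) h2
  have h4 : (p : ℤ) ≤ p ^ v := le_self_pow₀ (by omega) hv.ne'
  omega

theorem exists_eq_mul_of_gcd {m u v : ℕ} (hu : 0 < u) (hv : v = Nat.gcd m u)
    (hmv : m / v ≡ 0 [MOD 4]) :
    ∃ k j, m = v * (4 * k) ∧ u = v * (2 * j + 1) ∧ Nat.Coprime (4 * k) (2 * j + 1) := by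
  have hv0 : 0 < v := hv ▸ Nat.gcd_pos_of_pos_right m hu
  obtain ⟨a, ha⟩ : v ∣ m := hv ▸ Nat.gcd_dvd_left m u
  obtain ⟨b, hb⟩ : v ∣ u := hv ▸ Nat.gcd_dvd_right m u
  rw [ha, Nat.mul_div_cancel_left _ hv0] at hmv
  obtain ⟨k, rfl⟩ := (Nat.modEq_zero_iff_dvd).1 hmv
  have hco : Nat.Coprime (4 * k) b := by
    rw [ha, hb, Nat.gcd_mul_left] at hv
    exact (Nat.mul_left_cancel hv0 ((mul_one v).trans hv)).symm
  have hodd : Odd b := by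
    rw [← Nat.coprime_two_left]
    exact hco.coprime_dvd_left ⟨2 * k, by ring⟩
  obtain ⟨j, rfl⟩ := hodd
  exact ⟨k, j, ha, hb, hco⟩

theorem card_ker_frobeniusForm (hp : p ≠ 2) {m u v : ℕ} (hu : 0 < u)
    (hv : v = Nat.gcd m u) (hmv : m / v ≡ 0 [MOD 4]) (hF : Fintype.card F = p ^ m) :
    Nat.card (LinearMap.ker (frobeniusForm p F u + (frobeniusForm p F u).flip)) = p ^ (2 * v) := by
  classical
  obtain ⟨k, j, hm, huj, hco⟩ := exists_eq_mul_of_gcd hu hv hmv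
  have hg : Nat.gcd m (2 * v * (2 * j + 1)) = 2 * v := by
    rw [hm, show v * (4 * k) = 2 * v * (2 * k) by ring, Nat.gcd_mul_left,
      (hco.coprime_dvd_left ⟨2, by ring⟩ : Nat.Coprime (2 * k) (2 * j + 1)), mul_one]
  rw [← card_pow_eq_neg hp (show m = 2 * v * (2 * k) by rw [hm]; ring) hg hF,
    Nat.card_eq_fintype_card, ← Fintype.card_subtype]
  refine Fintype.card_congr (Equiv.subtypeEquivRight fun y => ?_)
  rw [mem_ker_frobeniusForm, huj, mul_assoc]

theorem frobeniusForm_gauss_sum (hp : p ≠ 2) {m u v : ℕ} (hu : 0 < u)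
    (hv : v = Nat.gcd m u) (hmv : m / v ≡ 0 [MOD 4]) (hF : Fintype.card F = p ^ m)
    {s : ZMod p} (hs : s ≠ 0) :
    ∑ y, stdAddChar (s * frobeniusForm p F u y y) = -(p : ℂ) ^ (m / 2 + v) := by
  have hker := card_ker_frobeniusForm hp hu hv hmv hF
  have hv0 : 0 < v := hv ▸ Nat.gcd_pos_of_pos_right m hu
  obtain ⟨k, j, hm, huj, -⟩ := exists_eq_mul_of_gcd hu hv hmv
  obtain ⟨S, hS, hsq, hsum⟩ := exists_int_frobeniusForm_gauss_sum hp
    (show m = 2 * v * (2 * k) by rw [hm]; ring) huj hF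
  rw [hker] at hsq
  -- `4 ∣ m / v` makes the exponent an odd multiple of `v`, hence the minus sign.
  have hm2 : m / 2 + v = v * (2 * k + 1) := by
    rw [hm, show v * (4 * k) = 2 * (v * (2 * k)) by ring, Nat.mul_div_cancel_left _ two_pos]
    ring
  have h := eq_neg_pow_of_sq_eq (b := 2 * k + 1) (Fact.out : p.Prime).one_lt hv0 (by simp) hS (by
    rw [hsq, hm]
    push_cast
    rw [← pow_add, ← pow_mul]
    congr 1
    ring)
  rw [hsum s hs, h, hm2]
  push_cast
  rfl

theorem frobeniusForm_half_gauss_sum (hp : p ≠ 2) {n : ℕ} (hn : 0 < n)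
    (hF : Fintype.card F = p ^ (2 * n)) {s : ZMod p} (hs : s ≠ 0) :
    ∑ y, stdAddChar (s * frobeniusForm p F n y y) = -(p : ℂ) ^ n := by
  obtain ⟨S, hS, hsq, hsum⟩ := exists_int_frobeniusForm_gauss_sum (F := F) (v := n) (e := 1)
    (u := n) (j := 0) hp (by ring) (by ring) hF
  have h2 := two_ne_zero_of_algebra_zmod F hp
  have hker : LinearMap.ker (frobeniusForm p F n + (frobeniusForm p F n).flip) = ⊥ := by
    rw [eq_bot_iff]
    intro y hy
    rw [mem_ker_frobeniusForm, ← hF, FiniteField.pow_card, eq_neg_iff_add_eq_zero, ← two_mul] at hy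
    exact (mul_eq_zero.1 hy).resolve_left h2
  rw [hker, Nat.card_unique, Nat.cast_one, mul_one] at hsq
  have h := eq_neg_pow_of_sq_eq (b := 1) (Fact.out : p.Prime).one_lt hn (by simp) hS (by
    rw [hsq, ← pow_mul]
    congr 1
    ring)
  rw [hsum s hs, h, mul_one]
  push_cast
  rfl

/-- With `σ x = x ^ p ^ n`, `i ^ 2 = -1`, `2 * α = 1 + i` and `2 * β = 1 - i`, the bijection
`x ↦ α * x + β * σ x` carries `x ↦ Tr (x ^ 2)` to `x ↦ Tr (x * σ x)`. -/
theorem trace_sq_gauss_sum (hp : p ≠ 2) {n : ℕ} (hn : 0 < n) (hn2 : Even n)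
    (hF : Fintype.card F = p ^ (2 * n)) {s : ZMod p} (hs : s ≠ 0) :
    ∑ x : F, stdAddChar (s * Algebra.trace (ZMod p) F (x ^ 2)) = -(p : ℂ) ^ n := by
  have h2 := two_ne_zero_of_algebra_zmod F hp
  -- As `n` is even, `p ^ n` is an odd square; hence `σ` fixes `i`.
  have hmod : p ^ n % 4 = 1 := by
    obtain ⟨k, rfl⟩ := hn2
    have hodd : Odd (p ^ k) := ((Fact.out : p.Prime).odd_of_ne_two hp).pow
    obtain ⟨t, ht⟩ := hodd
    have : p ^ (k + k) = 4 * (t ^ 2 + t) + 1 := by rw [pow_add, ht]; ring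
    omega
  obtain ⟨i, hi⟩ : IsSquare (-1 : F) := by
    rw [FiniteField.isSquare_neg_one_iff, hF, two_mul, pow_add, Nat.mul_mod, hmod]
    norm_num
  set σ := (FiniteField.frobeniusAlgHom (ZMod p) F) ^ n with hσ
  have hσa (x : F) : σ x = x ^ p ^ n := frobeniusAlgHom_pow_apply n x
  have hσσ (x : F) : σ (σ x) = x := by
    rw [hσa, hσa, ← pow_mul, ← pow_add, ← two_mul, ← hF, FiniteField.pow_card]
  have hσi : σ i = i := by
    have hi4 : i ^ 4 = 1 := by
      rw [show i ^ 4 = (i * i) * (i * i) by ring, ← hi]; ring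
    rw [hσa, ← Nat.div_add_mod (p ^ n) 4, hmod, pow_add, pow_mul, hi4, one_pow, one_mul, pow_one]
  set T : F → F := fun x => (1 + i) / 2 * x + (1 - i) / 2 * σ x with hT
  have hσT (x : F) : σ (T x) = (1 + i) / 2 * σ x + (1 - i) / 2 * x := by
    simp [hT, hσσ, hσi, map_ofNat σ 2]
  have hTT (x : F) : T (T x) = σ x := by
    change (1 + i) / 2 * T x + (1 - i) / 2 * σ (T x) = σ x
    rw [hσT]
    simp only [hT]
    field_simp
    linear_combination (2 * σ x - 2 * x) * hi
  have hinj : Function.Injective T := by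
    intro x y hxy
    have := congrArg T hxy
    rw [hTT, hTT] at this
    exact σ.toRingHom.injective this
  have hTsq (x : F) : Algebra.trace (ZMod p) F (T x ^ 2) = frobeniusForm p F n x x := by
    -- The first two terms form a difference `z - σ z`, of trace zero.
    have h3 : T x ^ 2 = i / 2 * x ^ 2 - σ (i / 2 * x ^ 2) + x * x ^ p ^ n := by
      rw [← hσa]
      simp only [hT, map_mul, map_div₀, map_pow, hσi, map_ofNat]
      field_simp
      linear_combination (-(x - σ x) ^ 2) * hi
    rw [h3, map_add, map_sub, hσa, trace_pow_pow, sub_self, zero_add, frobeniusForm_apply]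
  rw [← frobeniusForm_half_gauss_sum hp hn hF hs,
    ← Equiv.sum_comp (Equiv.ofBijective T (Finite.injective_iff_bijective.1 hinj))]
  refine Finset.sum_congr rfl fun x _ => ?_
  rw [Equiv.ofBijective_apply, hTsq]

end FrobeniusForm

/-! ### The three classes of nonzero functionals, their weights and sizes. -/

section WeightDistribution

open Finset ZMod

variable {p : ℕ} [Fact p.Prime] {V : Type*} [AddCommGroup V] [Module (ZMod p) V] [Fintype V]

/-- The number of zeros of the quadratic form `X ↦ B X X` at which `l` does not vanish. -/
def isotropicWeight (B : LinearMap.BilinForm (ZMod p) V) (l : Module.Dual (ZMod p) V) : ℕ :=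
  #{X | B X X = 0 ∧ l X ≠ 0}

variable {B : LinearMap.BilinForm (ZMod p) V}

theorem isotropicWeight_add (l : Module.Dual (ZMod p) V) :
    isotropicWeight B l + #{X | B X X = 0 ∧ l X = 0} = #{X | B X X = 0} := by
  rw [isotropicWeight, ← Finset.filter_filter, ← Finset.filter_filter, add_comm,
    Finset.card_filter_add_card_filter_not]

theorem isotropicWeight_zero : isotropicWeight B 0 = 0 := by
  simp [isotropicWeight]

variable {g : ℤ}

theorem sq_mul_isotropicWeight_of_notMem_range (hp : p ≠ 2)
    (hg : ∀ s : ZMod p, s ≠ 0 → ∑ X, stdAddChar (s * B X X) = (g : ℂ))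
    {l : Module.Dual (ZMod p) V} (hl : l ∉ LinearMap.range (B + B.flip)) :
    (p : ℤ) ^ 2 * isotropicWeight B l = (p - 1) * (Fintype.card V + (p - 1) * g) := by
  have h1 := mul_card_isotropic hg
  have h2 := mul_card_isotropic_of_notMem_range hp hg hl
  have h3 := isotropicWeight_add (B := B) l
  zify at h3
  linear_combination (p : ℤ) ^ 2 * h3 + p * h1 - h2

theorem sq_mul_isotropicWeight_of_isotropic
    (hg : ∀ s : ZMod p, s ≠ 0 → ∑ X, stdAddChar (s * B X X) = (g : ℂ))
    {l : Module.Dual (ZMod p) V} (hl0 : l ≠ 0) (hl : l ∈ (B + B.flip) '' {w | B w w = 0}) :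
    (p : ℤ) ^ 2 * isotropicWeight B l = (p - 1) * Fintype.card V := by
  obtain ⟨w, hw, rfl⟩ := hl
  have h1 := mul_card_isotropic hg
  have h2 := mul_card_isotropic_of_range hg hl0
  rw [Set.mem_ofPred_eq] at hw
  rw [if_pos hw] at h2
  have h3 := isotropicWeight_add (B := B) ((B + B.flip) w)
  zify at h3
  linear_combination (p : ℤ) ^ 2 * h3 + p * h1 - h2

omit [Fintype V] in
theorem ne_zero_of_mem_image_anisotropic (hp : p ≠ 2) {l : Module.Dual (ZMod p) V}
    (hl : l ∈ (B + B.flip) '' {w | B w w ≠ 0}) : l ≠ 0 := by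
  obtain ⟨w, hw, rfl⟩ := hl
  intro h
  have := isotropic_add_mem_ker hp 0 (LinearMap.mem_ker.2 h)
  simp only [zero_add, map_zero] at this
  exact hw this

theorem sq_mul_isotropicWeight_of_anisotropic (hp : p ≠ 2)
    (hg : ∀ s : ZMod p, s ≠ 0 → ∑ X, stdAddChar (s * B X X) = (g : ℂ))
    {l : Module.Dual (ZMod p) V} (hl : l ∈ (B + B.flip) '' {w | B w w ≠ 0}) :
    (p : ℤ) ^ 2 * isotropicWeight B l = (p - 1) * (Fintype.card V + p * g) := by
  have hl0 := ne_zero_of_mem_image_anisotropic hp hl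
  obtain ⟨w, hw, rfl⟩ := hl
  have h1 := mul_card_isotropic hg
  have h2 := mul_card_isotropic_of_range hg hl0
  rw [Set.mem_ofPred_eq] at hw
  rw [if_neg hw] at h2
  have h3 := isotropicWeight_add (B := B) ((B + B.flip) w)
  zify at h3
  linear_combination (p : ℤ) ^ 2 * h3 + p * h1 - h2

/-- Here `c = v - 1` and `d = m - v - 1`, which frees the exponents of truncated subtraction. As `0
< w₁ < w₂ < w₃`, each weight determines its class. -/
theorem isotropicWeight_distribution (hp : p ≠ 2) {c d : ℕ}
    (hV : Fintype.card V = p ^ (2 * c + 2 * d + 4))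
    (hR : Nat.card (LinearMap.ker (B + B.flip)) = p ^ (2 * c + 2))
    (hg : ∀ s : ZMod p, s ≠ 0 →
      ∑ X, stdAddChar (s * B X X) = (((p : ℤ) ^ (2 * c + d + 3) : ℤ) : ℂ)) :
    ∃ w₁ w₂ w₃ : ℕ,
      (w₁ : ℤ) = (p - 1) * p ^ (2 * c + 2 * d + 2) ∧
      (w₂ : ℤ) = (p - 1) * (p ^ (2 * c + 2 * d + 2) + (p - 1) * p ^ (2 * c + d + 1)) ∧
      (w₃ : ℤ) = (p - 1) * (p ^ (2 * c + 2 * d + 2) + p ^ (2 * c + d + 2)) ∧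
      0 < w₁ ∧ w₁ < w₂ ∧ w₂ < w₃ ∧
      (∀ l, isotropicWeight B l = 0 ↔ l = 0) ∧
      {l | isotropicWeight B l = w₁}.ncard = (p ^ (d + 1) - 1) * (p ^ d + 1) ∧
      {l | isotropicWeight B l = w₂}.ncard = p ^ (2 * c + 2 * d + 4) - p ^ (2 * d + 2) ∧
      {l | isotropicWeight B l = w₃}.ncard = (p ^ (d + 1) - 1) * p ^ d * (p - 1) ∧
      ∀ l, l ≠ 0 → isotropicWeight B l = w₁ ∨ isotropicWeight B l = w₂ ∨
        isotropicWeight B l = w₃ := by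
  have hfin : Finite (Module.Dual (ZMod p) V) := Module.finite_of_finite (ZMod p)
  have hp2 : 2 ≤ p := (Fact.out : p.Prime).two_le
  obtain ⟨r, hr⟩ : ∃ r, p = r + 1 := ⟨p - 1, by omega⟩
  have hr0 : 0 < r := by omega
  have hrp : ((p : ℤ) - 1) = r := by rw [hr]; push_cast; ring
  have hp0 : (p : ℤ) ^ 2 ≠ 0 := by positivity
  set Iso := (B + B.flip) '' {w | B w w = 0} with hIso
  set Aniso := (B + B.flip) '' {w | B w w ≠ 0} with hAniso
  set Compl := (LinearMap.range (B + B.flip) : Set (Module.Dual (ZMod p) V))ᶜ with hCompl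
  set w₁ := r * p ^ (2 * c + 2 * d + 2) with hw₁
  set w₂ := r * (p ^ (2 * c + 2 * d + 2) + r * p ^ (2 * c + d + 1)) with hw₂
  set w₃ := r * (p ^ (2 * c + 2 * d + 2) + p ^ (2 * c + d + 2)) with hw₃
  have e₁ : (w₁ : ℤ) = (p - 1) * p ^ (2 * c + 2 * d + 2) := by rw [hw₁, hrp]; push_cast; rfl
  have e₂ : (w₂ : ℤ) = (p - 1) * (p ^ (2 * c + 2 * d + 2) + (p - 1) * p ^ (2 * c + d + 1)) := by
    rw [hw₂, hrp]; push_cast; rfl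
  have e₃ : (w₃ : ℤ) = (p - 1) * (p ^ (2 * c + 2 * d + 2) + p ^ (2 * c + d + 2)) := by
    rw [hw₃, hrp]; push_cast; rfl
  have hpos : 0 < w₁ := by positivity
  have h12 : w₁ < w₂ := by
    rw [hw₁, hw₂]
    have : 0 < r * p ^ (2 * c + d + 1) := by positivity
    exact Nat.mul_lt_mul_of_pos_left (by omega) hr0
  have h23 : w₂ < w₃ := by
    rw [hw₂, hw₃]
    have h : r * p ^ (2 * c + d + 1) < p ^ (2 * c + d + 2) := by
      rw [pow_succ' p (2 * c + d + 1)]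
      exact Nat.mul_lt_mul_of_pos_right (by omega) (by positivity)
    exact Nat.mul_lt_mul_of_pos_left (by omega) hr0
  have hclass₁ : ∀ l, l ≠ 0 → l ∈ Iso → isotropicWeight B l = w₁ := by
    intro l h0 hl
    have h := sq_mul_isotropicWeight_of_isotropic hg h0 hl
    zify
    apply mul_left_cancel₀ hp0
    rw [h, hV, e₁]
    push_cast
    ring
  have hclass₂ : ∀ l, l ∈ Compl → isotropicWeight B l = w₂ := by
    intro l hl
    have h := sq_mul_isotropicWeight_of_notMem_range hp hg hl
    zify
    apply mul_left_cancel₀ hp0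
    rw [h, hV, e₂]
    push_cast
    ring
  have hclass₃ : ∀ l, l ∈ Aniso → isotropicWeight B l = w₃ := by
    intro l hl
    have h := sq_mul_isotropicWeight_of_anisotropic hp hg hl
    zify
    apply mul_left_cancel₀ hp0
    rw [h, hV, e₃]
    push_cast
    ring
  have hcases : ∀ l, l = 0 ∨ (l ≠ 0 ∧ l ∈ Iso) ∨ l ∈ Compl ∨ l ∈ Aniso := by
    intro l
    by_cases h0 : l = 0
    · exact Or.inl h0
    by_cases hl : l ∈ LinearMap.range (B + B.flip)
    · obtain ⟨w, rfl⟩ := hl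
      by_cases hw : B w w = 0
      · exact Or.inr (Or.inl ⟨h0, w, hw, rfl⟩)
      · exact Or.inr (Or.inr (Or.inr ⟨w, hw, rfl⟩))
    · exact Or.inr (Or.inr (Or.inl hl))
  have hz : isotropicWeight B 0 = 0 := isotropicWeight_zero
  have hN := mul_card_isotropic hg
  have hI := card_ker_mul_ncard_isotropic B hp
  have hA := card_ker_mul_ncard_anisotropic B hp
  have hC := card_ker_mul_ncard_range_compl B
  rw [hR] at hI hA hC
  rw [hV] at hN hA hC
  have hR0 : 0 < p ^ (2 * c + 2) := by positivity
  refine ⟨w₁, w₂, w₃, e₁, e₂, e₃, hpos, h12, h23, ?_, ?_, ?_, ?_, ?_⟩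
  · intro l
    refine ⟨fun h => ?_, fun h => h ▸ hz⟩
    rcases hcases l with h1 | h1 | h1 | h1
    · exact h1
    · have := hclass₁ l h1.1 h1.2; omega
    · have := hclass₂ l h1; omega
    · have := hclass₃ l h1; omega
  · have hset : {l | isotropicWeight B l = w₁} = Iso \ {0} := by
      ext l
      simp only [Set.mem_ofPred_eq, Set.mem_sdiff, Set.mem_singleton_iff]
      refine ⟨fun h => ?_, fun h => hclass₁ l h.2 h.1⟩
      rcases hcases l with h1 | h1 | h1 | h1
      · rw [h1, hz] at h; omega
      · exact h1.symm
      · have := hclass₂ l h1; omega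
      · have := hclass₃ l h1; omega
    -- The zero functional is the image of `w = 0` and must be removed from this class.
    have h0 : (0 : Module.Dual (ZMod p) V) ∈ Iso := ⟨0, by simp, by simp⟩
    rw [hset, Set.ncard_sdiff_singleton_of_mem h0]
    have hIc : Iso.ncard = (p ^ (d + 1) - 1) * (p ^ d + 1) + 1 := by
      have hpd : 1 ≤ p ^ (d + 1) := Nat.one_le_pow _ _ (by omega)
      have hp0' : (p : ℤ) * p ^ (2 * c + 2) ≠ 0 := by positivity
      zify [hpd] at hI ⊢
      apply mul_left_cancel₀ hp0'
      rw [mul_assoc, hI, hN]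
      push_cast
      ring
    rw [hIc, Nat.add_sub_cancel]
  · have hset : {l | isotropicWeight B l = w₂} = Compl := by
      ext l
      simp only [Set.mem_ofPred_eq]
      refine ⟨fun h => ?_, fun h => hclass₂ l h⟩
      rcases hcases l with h1 | h1 | h1 | h1
      · rw [h1, hz] at h; omega
      · have := hclass₁ l h1.1 h1.2; omega
      · exact h1
      · have := hclass₃ l h1; omega
    rw [hset]
    apply Nat.eq_sub_of_add_eq
    apply Nat.eq_of_mul_eq_mul_left hR0
    rw [mul_add, ← hC]
    ring
  · have hset : {l | isotropicWeight B l = w₃} = Aniso := by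
      ext l
      simp only [Set.mem_ofPred_eq]
      refine ⟨fun h => ?_, fun h => hclass₃ l h⟩
      rcases hcases l with h1 | h1 | h1 | h1
      · rw [h1, hz] at h; omega
      · have := hclass₁ l h1.1 h1.2; omega
      · have := hclass₂ l h1; omega
      · exact h1
    rw [hset]
    have hpd : 1 ≤ p ^ (d + 1) := Nat.one_le_pow _ _ (by omega)
    have hp1 : 1 ≤ p := by omega
    have hp0' : (p : ℤ) * p ^ (2 * c + 2) ≠ 0 := by positivity
    zify [hpd, hp1] at hA ⊢
    apply mul_left_cancel₀ hp0'
    push_cast at hN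
    linear_combination p * hA - hN
  · intro l h0
    rcases hcases l with h1 | h1 | h1 | h1
    · exact absurd h1 h0
    · exact Or.inl (hclass₁ l h1.1 h1.2)
    · exact Or.inr (Or.inl (hclass₂ l h1))
    · exact Or.inr (Or.inr (hclass₃ l h1))

end WeightDistribution

/-! ### From the quadratic form on `F × F` to the code. -/

section DefiningSetCode

open Finset ZMod

variable {p : ℕ} [Fact p.Prime] {F : Type*} [Field F] [Algebra (ZMod p) F]

variable (p F) in
/-- The bilinear form on `F × F` whose diagonal is `(x, y) ↦ Tr (x ^ 2 + y ^ (p ^ u + 1))`. -/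
noncomputable def pairForm (u : ℕ) : LinearMap.BilinForm (ZMod p) (F × F) :=
  (frobeniusForm p F 0).compl₁₂ (LinearMap.fst _ F F) (LinearMap.fst _ F F) +
    (frobeniusForm p F u).compl₁₂ (LinearMap.snd _ F F) (LinearMap.snd _ F F)

theorem pairForm_apply (u : ℕ) (X Y : F × F) :
    pairForm p F u X Y = frobeniusForm p F 0 X.1 Y.1 + frobeniusForm p F u X.2 Y.2 := rfl

theorem pairForm_self (u : ℕ) (X : F × F) :
    pairForm p F u X X = Algebra.trace (ZMod p) F (X.1 ^ 2 + X.2 ^ (p ^ u + 1)) := by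
  rw [pairForm_apply, frobeniusForm_apply, frobeniusForm_apply, ← map_add]
  congr 1
  ring

variable [Fintype F]

/-- The polar form is an orthogonal sum; on the first factor, the case `u = 0`, the radical equation
is `2 * y = 0`. -/
theorem ker_pairForm (hp : p ≠ 2) (u : ℕ) :
    LinearMap.ker (pairForm p F u + (pairForm p F u).flip) =
      (⊥ : Submodule (ZMod p) F).prod
        (LinearMap.ker (frobeniusForm p F u + (frobeniusForm p F u).flip)) := by
  have hbot : LinearMap.ker (frobeniusForm p F 0 + (frobeniusForm p F 0).flip) = ⊥ := by
    rw [eq_bot_iff]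
    intro y hy
    rw [mem_ker_frobeniusForm, mul_zero, pow_zero, pow_one, eq_neg_iff_add_eq_zero,
      ← two_mul] at hy
    exact (mul_eq_zero.1 hy).resolve_left (two_ne_zero_of_algebra_zmod F hp)
  rw [← hbot]
  ext X
  have h (Y : F × F) : (pairForm p F u + (pairForm p F u).flip) X Y =
      (frobeniusForm p F 0 + (frobeniusForm p F 0).flip) X.1 Y.1 +
      (frobeniusForm p F u + (frobeniusForm p F u).flip) X.2 Y.2 := by
    simp only [LinearMap.add_apply, LinearMap.BilinForm.flip_apply, pairForm_apply]
    ring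
  rw [Submodule.mem_prod, LinearMap.mem_ker, LinearMap.mem_ker, LinearMap.mem_ker]
  constructor
  · intro hX
    constructor <;> ext y
    · have := h (y, 0)
      rw [hX] at this
      simpa using! this.symm
    · have := h (0, y)
      rw [hX] at this
      simpa using! this.symm
  · rintro ⟨h1, h2⟩
    refine LinearMap.ext fun Y => ?_
    rw [h, h1, h2]
    simp

theorem card_ker_pairForm (hp : p ≠ 2) {m u v : ℕ} (hu : 0 < u)
    (hv : v = Nat.gcd m u) (hmv : m / v ≡ 0 [MOD 4]) (hF : Fintype.card F = p ^ m) :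
    Nat.card (LinearMap.ker (pairForm p F u + (pairForm p F u).flip)) = p ^ (2 * v) := by
  rw [ker_pairForm hp, ← card_ker_frobeniusForm hp hu hv hmv hF]
  refine Nat.card_congr ⟨fun X => ⟨X.1.2, X.2.2⟩, fun y => ⟨(0, y.1), rfl, y.2⟩, ?_, fun _ => rfl⟩
  rintro ⟨⟨x, y⟩, hx, hy⟩
  exact Subtype.ext (Prod.ext (Submodule.mem_bot _ |>.1 hx).symm rfl)

/-- The sum factors over the coordinates as `-p ^ (m / 2)` times `-p ^ (m / 2 + v)`; the signs
cancel. -/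
theorem pairForm_gauss_sum (hp : p ≠ 2) {m u v : ℕ} (hm : 0 < m) (hu : 0 < u)
    (hv : v = Nat.gcd m u) (hmv : m / v ≡ 0 [MOD 4]) (hF : Fintype.card F = p ^ m)
    {s : ZMod p} (hs : s ≠ 0) :
    ∑ X, stdAddChar (s * pairForm p F u X X) = (p : ℂ) ^ (m + v) := by
  obtain ⟨k, j, hmk, -, -⟩ := exists_eq_mul_of_gcd hu hv hmv
  have hm2 : m = 2 * (m / 2) := by
    have : m = 2 * (v * (2 * k)) := by rw [hmk]; ring
    omega
  have heven : Even (m / 2) := by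
    have : m = 2 * (2 * (v * k)) := by rw [hmk]; ring
    exact ⟨v * k, by omega⟩
  have h1 := trace_sq_gauss_sum (F := F) hp (n := m / 2) (by omega) heven (by rw [← hm2, hF]) hs
  have h2 := frobeniusForm_gauss_sum hp hu hv hmv hF hs
  calc ∑ X, stdAddChar (s * pairForm p F u X X)
      = (∑ x : F, stdAddChar (s * Algebra.trace (ZMod p) F (x ^ 2)) : ℂ) *
        ∑ y, stdAddChar (s * frobeniusForm p F u y y) := by
        rw [Fintype.sum_prod_type, Finset.sum_mul_sum]
        refine Finset.sum_congr rfl fun x _ => Finset.sum_congr rfl fun y _ => ?_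
        rw [← AddChar.map_add_eq_mul, ← mul_add, pairForm_apply, frobeniusForm_apply,
          pow_zero, pow_one, sq]
    _ = (p : ℂ) ^ (m + v) := by
        rw [h1, h2, neg_mul_neg, ← pow_add]
        congr 1
        omega

variable (p F) in
/-- The functional `(x, y) ↦ Tr (a * x + b * y)` attached to `(a, b)`. -/
noncomputable def traceFunctional : F × F →ₗ[ZMod p] Module.Dual (ZMod p) (F × F) :=
  (Algebra.traceForm (ZMod p) F).compl₁₂ (LinearMap.fst _ F F) (LinearMap.fst _ F F) +
    (Algebra.traceForm (ZMod p) F).compl₁₂ (LinearMap.snd _ F F) (LinearMap.snd _ F F)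

omit [Fintype F] in
theorem traceFunctional_apply (X Y : F × F) :
    traceFunctional p F X Y = Algebra.trace (ZMod p) F (X.1 * Y.1 + X.2 * Y.2) := by
  rw [map_add]
  rfl

theorem traceFunctional_surjective : Function.Surjective (traceFunctional p F) := by
  have hinj : Function.Injective (traceFunctional p F) := by
    rw [injective_iff_map_eq_zero]
    intro X hX
    have h (Y : F × F) : Algebra.trace (ZMod p) F (X.1 * Y.1 + X.2 * Y.2) = 0 := by
      rw [← traceFunctional_apply, hX]
      rfl
    ext
    · exact trace_mul_eq_zero (p := p) fun x => by simpa using h (x, 0)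
    · exact trace_mul_eq_zero (p := p) fun y => by simpa using h (0, y)
  exact (LinearMap.injective_iff_surjective_of_finrank_eq_finrank
    Subspace.dual_finrank_eq.symm).1 hinj

omit [Fintype F] in
/-- Restriction of functionals on `F × F` to a finite set. -/
def restrictFunctional (D : Finset (F × F)) :
    Module.Dual (ZMod p) (F × F) →ₗ[ZMod p] (D → ZMod p) where
  toFun l := fun X => l X
  map_add' _ _ := rfl
  map_smul' _ _ := rfl

/-- Every functional on `F × F` comes from a pair `(a, b)`, so the whole dual space can parametrize
the code. -/
theorem codeOf_eq_range (D : Finset (F × F)) :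
    LinearCode.codeOf p D = LinearMap.range (restrictFunctional (p := p) D) := by
  have : LinearCode.codeword p D = restrictFunctional D ∘ₗ traceFunctional p F := by
    refine LinearMap.ext fun X => ?_
    funext Y
    exact (traceFunctional_apply X Y).symm
  rw [LinearCode.codeOf, this, LinearMap.range_comp,
    LinearMap.range_eq_top.2 traceFunctional_surjective, Submodule.map_top]

variable [DecidableEq F]

theorem D₂_eq (u : ℕ) :
    LinearCode.D₂ p F u = ({X | pairForm p F u X X = 0} : Finset (F × F)).erase 0 := by
  ext X
  simp only [LinearCode.D₂, Finset.mem_filter, Finset.mem_univ, true_and, Finset.mem_erase,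
    pairForm_self]
  rfl

/-- Omitting the origin from `D₂` loses nothing, since `l 0 = 0`. -/
theorem hammingNorm_restrictFunctional (u : ℕ) (l : Module.Dual (ZMod p) (F × F)) :
    hammingNorm (restrictFunctional (LinearCode.D₂ p F u) l) =
      isotropicWeight (pairForm p F u) l := by
  rw [hammingNorm, isotropicWeight]
  refine Finset.card_bij (fun X _ => X.1) ?_ ?_ ?_
  · rintro ⟨X, hX⟩ hl
    rw [D₂_eq] at hX
    have hX := (Finset.mem_filter.1 (Finset.mem_of_mem_erase hX)).2
    have hl := (Finset.mem_filter.1 hl).2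
    exact Finset.mem_filter.2 ⟨Finset.mem_univ _, hX, hl⟩
  · intro X _ Y _ h
    exact Subtype.ext h
  · intro X hX
    obtain ⟨-, h1, h2⟩ := Finset.mem_filter.1 hX
    refine ⟨⟨X, ?_⟩, Finset.mem_filter.2 ⟨Finset.mem_univ _, h2⟩, rfl⟩
    rw [D₂_eq]
    refine Finset.mem_erase.2 ⟨?_, Finset.mem_filter.2 ⟨Finset.mem_univ _, h1⟩⟩
    rintro rfl
    exact h2 (map_zero l)

theorem weightCount_D₂ {u : ℕ}
    (hinj : Function.Injective (restrictFunctional (p := p) (LinearCode.D₂ p F u))) (i : ℕ) :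
    LinearCode.weightCount (LinearCode.codeOf p (LinearCode.D₂ p F u)) i =
      {l | isotropicWeight (pairForm p F u) l = i}.ncard := by
  rw [LinearCode.weightCount, codeOf_eq_range, ← Set.ncard_image_of_injective _ hinj]
  congr 1
  ext c
  simp only [Set.mem_ofPred_eq, Set.mem_image, LinearMap.mem_range]
  constructor
  · rintro ⟨⟨l, rfl⟩, h⟩
    exact ⟨l, by rw [← h, hammingNorm_restrictFunctional], rfl⟩
  · rintro ⟨l, h, rfl⟩
    exact ⟨⟨l, rfl⟩, by rw [hammingNorm_restrictFunctional, h]⟩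

end DefiningSetCode

/-! ### The main theorem. -/

theorem theorem6 (p : ℕ) [Fact p.Prime] (hp : p ≠ 2) (m u v : ℕ) (hm : 0 < m) (hu : 0 < u)
    (hv : v = Nat.gcd m u) (hmv : m / v ≡ 0 [MOD 4])
    (F : Type*) [Field F] [Fintype F] [DecidableEq F] [Algebra (ZMod p) F]
    (hF : Fintype.card F = p ^ m) :
    LinearCode.HasParameters (LinearCode.codeOf p (LinearCode.D₂ p F u))
      (p ^ (2 * m - 1) + p ^ (m + v) - p ^ (m + v - 1) - 1) (2 * m) ∧
    LinearCode.IsTWeight (LinearCode.codeOf p (LinearCode.D₂ p F u)) 3 ∧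
    LinearCode.weightCount (LinearCode.codeOf p (LinearCode.D₂ p F u)) 0 = 1 ∧
    ∃ w₁ w₂ w₃ : ℕ,
      (w₁ : ℚ) = ((p : ℚ) - 1) * (p : ℚ) ^ (2 * m - 2) ∧
      (w₂ : ℚ) = ((p : ℚ) - 1) * (p : ℚ) ^ (2 * m - 2) *
        (1 + ((p : ℚ) - 1) / (p : ℚ) ^ (m - v)) ∧
      (w₃ : ℚ) = ((p : ℚ) - 1) * (p : ℚ) ^ (2 * m - 2) *
        (1 + 1 / (p : ℚ) ^ (m - v - 1)) ∧
      LinearCode.weightCount (LinearCode.codeOf p (LinearCode.D₂ p F u)) w₁ =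
        (p ^ (m - v) - 1) * (p ^ (m - v - 1) + 1) ∧
      LinearCode.weightCount (LinearCode.codeOf p (LinearCode.D₂ p F u)) w₂ =
        p ^ (2 * m) - p ^ (2 * m - 2 * v) ∧
      LinearCode.weightCount (LinearCode.codeOf p (LinearCode.D₂ p F u)) w₃ =
        (p ^ (m - v) - 1) * p ^ (m - v - 1) * (p - 1) ∧
      ∀ w : ℕ, w ≠ 0 → w ≠ w₁ → w ≠ w₂ → w ≠ w₃ →
        LinearCode.weightCount (LinearCode.codeOf p (LinearCode.D₂ p F u)) w = 0 := by
  have hp2 : 2 ≤ p := (Fact.out : p.Prime).two_le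
  have hv0 : 0 < v := hv ▸ Nat.gcd_pos_of_pos_right m hu
  have hvm : v < m := by
    obtain ⟨k, j, hmk, -, -⟩ := exists_eq_mul_of_gcd hu hv hmv
    have hk : 0 < k := Nat.pos_of_ne_zero (by rintro rfl; omega)
    nlinarith
  have hcardV : Fintype.card (F × F) = p ^ (2 * m) := by
    rw [Fintype.card_prod, hF, ← pow_add, two_mul]
  have hker := card_ker_pairForm hp hu hv hmv hF
  have hgauss : ∀ s : ZMod p, s ≠ 0 → ∑ X, ZMod.stdAddChar (s * pairForm p F u X X) =
      (((p : ℤ) ^ (m + v) : ℤ) : ℂ) := by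
    intro s hs
    rw [pairForm_gauss_sum hp hm hu hv hmv hF hs]
    push_cast
    rfl
  have hfinrank : Module.finrank (ZMod p) (Module.Dual (ZMod p) (F × F)) = 2 * m := by
    rw [Subspace.dual_finrank_eq]
    have h := Module.natCard_eq_pow_finrank (K := ZMod p) (V := F × F)
    rw [Nat.card_eq_fintype_card, hcardV, Nat.card_zmod] at h
    exact (Nat.pow_right_injective hp2 h).symm
  have hN := mul_card_isotropic hgauss
  have hlen : Fintype.card (LinearCode.D₂ p F u) + 1 =
      (Finset.univ.filter fun X => pairForm p F u X X = 0).card := by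
    rw [Fintype.card_coe, D₂_eq]
    exact Finset.card_erase_add_one (by simp)
  clear hv hmv
  obtain ⟨c, rfl⟩ : ∃ c, v = c + 1 := ⟨v - 1, by omega⟩
  obtain ⟨d, rfl⟩ : ∃ d, m = c + d + 2 := ⟨m - c - 2, by omega⟩
  have x6 : c + d + 2 + (c + 1) = 2 * c + d + 3 := by omega
  obtain ⟨w₁, w₂, w₃, e₁, e₂, e₃, hpos, h12, h23, hzero, hc₁, hc₂, hc₃, hall⟩ :=
    isotropicWeight_distribution (B := pairForm p F u) hp (c := c) (d := d)
      (by rw [hcardV]; congr 1; ring) (by rw [hker]; congr 1)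
      (by intro s hs; rw [hgauss s hs, x6])
  -- Only `l = 0` has weight zero, so restriction to `D₂` is injective; this gives the dimension and
  -- lets functionals be counted in place of codewords.
  have hinj : Function.Injective (restrictFunctional (p := p) (LinearCode.D₂ p F u)) := by
    rw [injective_iff_map_eq_zero]
    intro l hl
    rw [← hzero, ← hammingNorm_restrictFunctional, hl, hammingNorm_zero]
  have hwc := weightCount_D₂ hinj
  have hw0 (w : ℕ) (h0 : w ≠ 0) (h1 : w ≠ w₁) (h2 : w ≠ w₂) (h3 : w ≠ w₃) :
      LinearCode.weightCount (LinearCode.codeOf p (LinearCode.D₂ p F u)) w = 0 := by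
    rw [hwc]
    refine (congrArg Set.ncard (Set.eq_empty_of_forall_notMem fun l hl => ?_)).trans
      (Set.ncard_empty _)
    rw [Set.mem_ofPred_eq] at hl
    have hl0 : l ≠ 0 := fun h => h0 (by rw [← hl]; exact (hzero l).2 h)
    rcases hall l hl0 with h | h | h <;> omega
  have hpd : 1 < p ^ (d + 1) := Nat.one_lt_pow (by omega) (by omega)
  have hsub : p ^ (d + 1) - 1 ≠ 0 := by omega
  have hne₁ : LinearCode.weightCount (LinearCode.codeOf p (LinearCode.D₂ p F u)) w₁ ≠ 0 := by
    rw [hwc, hc₁]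
    exact mul_ne_zero hsub (by omega)
  have hne₂ : LinearCode.weightCount (LinearCode.codeOf p (LinearCode.D₂ p F u)) w₂ ≠ 0 := by
    rw [hwc, hc₂]
    exact (Nat.sub_pos_of_lt (Nat.pow_lt_pow_right (by omega) (by omega))).ne'
  have hne₃ : LinearCode.weightCount (LinearCode.codeOf p (LinearCode.D₂ p F u)) w₃ ≠ 0 := by
    rw [hwc, hc₃]
    exact mul_ne_zero (mul_ne_zero hsub (by positivity)) (by omega)
  have hle (w : ℕ) (h : LinearCode.weightCount (LinearCode.codeOf p (LinearCode.D₂ p F u)) w ≠ 0) :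
      w ≤ Fintype.card (LinearCode.D₂ p F u) := by
    obtain ⟨x, -, rfl⟩ := Set.nonempty_of_ncard_ne_zero h
    exact hammingNorm_le_card_fintype
  have hp0 : (p : ℚ) ≠ 0 := by positivity
  have x1 : 2 * (c + d + 2) - 1 = 2 * c + 2 * d + 3 := by omega
  have x2 : 2 * (c + d + 2) - 2 = 2 * c + 2 * d + 2 := by omega
  have x3 : c + d + 2 + (c + 1) - 1 = 2 * c + d + 2 := by omega
  have x4 : c + d + 2 - (c + 1) = d + 1 := by omega
  have x5 : 2 * (c + d + 2) - 2 * (c + 1) = 2 * d + 2 := by omega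
  refine ⟨⟨?_, ?_⟩, ?_, ?_, w₁, w₂, w₃, ?_, ?_, ?_, ?_, ?_, ?_, hw0⟩
  · rw [x1, x3, x6]
    have hlt : p ^ (2 * c + d + 2) ≤ p ^ (2 * c + d + 3) :=
      Nat.pow_le_pow_right (by omega) (by omega)
    suffices h : Fintype.card (LinearCode.D₂ p F u) + 1 + p ^ (2 * c + d + 2) =
        p ^ (2 * c + 2 * d + 3) + p ^ (2 * c + d + 3) by omega
    rw [hlen]
    have hpz : (p : ℤ) ≠ 0 := by positivity
    zify
    apply mul_left_cancel₀ hpz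
    rw [mul_add, hN, hcardV]
    push_cast
    ring
  · rw [codeOf_eq_range, LinearMap.finrank_range_of_inj hinj, hfinrank]
  · rw [LinearCode.IsTWeight]
    have hset : {i : ℕ | 1 ≤ i ∧ i ≤ Fintype.card (LinearCode.D₂ p F u) ∧
        LinearCode.weightCount (LinearCode.codeOf p (LinearCode.D₂ p F u)) i ≠ 0} =
        ({w₁, w₂, w₃} : Finset ℕ) := by
      ext i
      simp only [Set.mem_ofPred_eq, Finset.coe_insert, Finset.coe_singleton,
        Set.mem_insert_iff, Set.mem_singleton_iff]
      constructor
      · rintro ⟨h1, -, h2⟩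
        by_contra! h
        exact h2 (hw0 i (by omega) h.1 h.2.1 h.2.2)
      · rintro (rfl | rfl | rfl)
        · exact ⟨by omega, hle _ hne₁, hne₁⟩
        · exact ⟨by omega, hle _ hne₂, hne₂⟩
        · exact ⟨by omega, hle _ hne₃, hne₃⟩
    rw [hset, Set.ncard_coe_finset]
    exact Finset.card_eq_three.2 ⟨w₁, w₂, w₃, by omega, by omega, by omega, rfl⟩
  · rw [hwc]
    simp only [hzero]
    exact Set.ncard_singleton 0
  · rw [x2]
    exact_mod_cast congrArg (Int.cast : ℤ → ℚ) e₁
  · have h : (w₂ : ℚ) = (p - 1) * (p ^ (2 * c + 2 * d + 2) + (p - 1) * p ^ (2 * c + d + 1)) := by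
      exact_mod_cast congrArg (Int.cast : ℤ → ℚ) e₂
    rw [x2, x4, h]
    field_simp
    ring
  · have h : (w₃ : ℚ) = (p - 1) * (p ^ (2 * c + 2 * d + 2) + p ^ (2 * c + d + 2)) := by
      exact_mod_cast congrArg (Int.cast : ℤ → ℚ) e₃
    rw [x2, x4, h, Nat.add_sub_cancel]
    field_simp
    ring
  · rw [hwc, hc₁, x4, Nat.add_sub_cancel]
  · rw [hwc, hc₂, x5]
    congr 2
    ring
  · rw [hwc, hc₃, x4, Nat.add_sub_cancel]
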